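/- Let $\psi>0$ and $\xi<1/4$, and let $\mathrm{GPD}(\xi,\psi)$ be the generalized Pareto distribution, i.e. the distribution supported on $\{x\ge 0:\ 1+\xi x/\psi\ge 0\}$ with distribution function $F(x)=1-(1+\xi x/\psi)^{-1/\xi}$ there (and $F(x)=1-e^{-x/\psi}$ if $\xi=0$). Let $X_1,X_2,\dots$ be i.i.d. with distribution $\mathrm{GPD}(\xi,\psi)$, and let $t\ge 0$ be a fixed threshold with $\psi+\xi t>0$ (that is, $F(t)<1$). For the sample $X_1,\dots,X_n$ let $n(t)=\sum_{j=1}^n 1_{(X_j>t)}$ be the number of exceedances, and let $$cv(t)=\frac{\mathrm{sd}\{X_j-t : j\le n,\ X_j>t\}}{\mathrm{mean}\{X_j-t : j\le n,\ X_j>t\}}$$ be the empirical coefficient of variation of the threshold excesses, where $\mathrm{sd}$ is the sample standard deviation with divisor either $n(t)$ or $n(t)-1$ (and $cv(t)=0$, say, when it is undefined). Put $c_\xi=\sqrt{1/(1-2\xi)}$. Then, as $n\to\infty$, $$\sqrt{n(t)}\,\bigl(cv(t)-c_\xi\bigr)\ \overset{d}{\longrightarrow}\ N(0,\sigma_\xi^2),\qquad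 \sigma_\xi^2=\frac{(1-\xi)^2(6\xi^2-\xi+1)}{(1-2\xi)^2(1-3\xi)(1-4\xi)}.$$ In particular $\sigma_0^2=1$ and $\sigma_{-1}^2=8/45$. -/

import Mathlib

open MeasureTheory ProbabilityTheory Filter

/-- Distribution function of the generalized Pareto distribution with shape `ξ` and scale `ψ > 0`:
it is `1 - (1 + ξ x / ψ) ^ (-1 / ξ)` on the range `x > 0`, `1 + ξ x / ψ > 0` (with the exponential
distribution as the limit case `ξ = 0`), `0` to the left of this range and `1` to the right. -/
noncomputable def gpdCDF (ξ ψ x : ℝ) : ℝ :=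
  if x ≤ 0 then 0
  else if ξ = 0 then 1 - Real.exp (-x / ψ)
  else if 1 + ξ * x / ψ ≤ 0 then 1
  else 1 - (1 + ξ * x / ψ) ^ (-1 / ξ)

/-- The measure `ν` on the real line is the law `GPD(ξ, ψ)`. -/
def IsGPD (ξ ψ : ℝ) (ν : Measure ℝ) : Prop :=
  IsProbabilityMeasure ν ∧ ∀ x : ℝ, cdf ν x = gpdCDF ξ ψ x

/-- The coefficient of variation `c_ξ` of a `GPD(ξ, ψ)`. -/
noncomputable def gpdCV (ξ : ℝ) : ℝ :=
  √(1 / (1 - 2 * ξ))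

/-- The asymptotic variance `σ_ξ²`. -/
noncomputable def gpdAsympVar (ξ : ℝ) : ℝ :=
  (1 - ξ) ^ 2 * (6 * ξ ^ 2 - ξ + 1) / ((1 - 2 * ξ) ^ 2 * (1 - 3 * ξ) * (1 - 4 * ξ))

/-- The indices of the exceedances of `t` in the sample `x 0, …, x (n - 1)`. -/
noncomputable def exceedances (x : ℕ → ℝ) (n : ℕ) (t : ℝ) : Finset ℕ :=
  (Finset.range n).filter (fun j => t < x j)

/-- The number `n(t)` of exceedances. -/
noncomputable def numExceedances (x : ℕ → ℝ) (n : ℕ) (t : ℝ) : ℕ :=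
  (exceedances x n t).card

/-- The sample mean of the threshold excesses `x j - t`, `x j > t`. -/
noncomputable def meanExcess (x : ℕ → ℝ) (n : ℕ) (t : ℝ) : ℝ :=
  (∑ j ∈ exceedances x n t, (x j - t)) / (numExceedances x n t : ℝ)

/-- The sample standard deviation of the threshold excesses, the sum of squares being divided by
`n(t) - d`: `d = 0` and `d = 1` are the two usual conventions. -/
noncomputable def sdExcess (d : ℕ) (x : ℕ → ℝ) (n : ℕ) (t : ℝ) : ℝ :=
  √((∑ j ∈ exceedances x n t, ((x j - t) - meanExcess x n t) ^ 2) /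
    ((numExceedances x n t : ℝ) - (d : ℝ)))

/-- The empirical residual coefficient of variation `cv(t)`. -/
noncomputable def residualCV (d : ℕ) (x : ℕ → ℝ) (n : ℕ) (t : ℝ) : ℝ :=
  sdExcess d x n t / meanExcess x n t

/-! No conditioning on the random number n(t) is needed: cv(t) is a function of the sums S_k of (X_j
- t)^k over X_j > t, which are i.i.d. sums over the whole sample, with S_0 = n(t). Let a, b, e be
S_0/n, S_1/n, S_2/n, let p = P(X > t), let m_k be the moments of the excesses, and c = c_ξ. Up to
the choice of divisor, cv² - c² = (a e - (1 + c²) b²) / b². As m_2 = (1 + c²) m_1², the numerator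
equals a W - (1 + c²) V², where W and V are averages of centered i.i.d. variables. The central limit
theorem handles W, V² is o(1/√n) in probability, and Slutsky's theorem gives
`tendstoInDistribution_residualCV`.

For the moments, GPD(ξ, ψ) is the law of q(U), with U standard exponential and q' = ψ + ξ q, q(0) =
0. Lack of memory of U and the flow property of this equation show that excesses over t follow
GPD(ξ, ψ + ξ t). Integrating (q^(k+1) e^(-u))' gives the moment recursion. The scale cancels in the
variance. -/

open scoped Topology

/-- The `k`-th power of the excess of `x` over `t`, and `0` if `x` does not exceed `t`. -/
noncomputable def excessPow (t : ℝ) (k : ℕ) (x : ℝ) : ℝ :=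
  if t < x then (x - t) ^ k else 0

lemma measurable_excessPow (t : ℝ) (k : ℕ) : Measurable (excessPow t k) :=
  Measurable.ite measurableSet_Ioi (by fun_prop) measurable_const

lemma excessPow_mul (t : ℝ) (k l : ℕ) (x : ℝ) :
    excessPow t k x * excessPow t l x = excessPow t (k + l) x := by
  unfold excessPow
  split_ifs <;> simp [pow_add]

lemma sum_exceedances_pow (x : ℕ → ℝ) (n : ℕ) (t : ℝ) (k : ℕ) :
    ∑ j ∈ exceedances x n t, (x j - t) ^ k = ∑ j ∈ Finset.range n, excessPow t k (x j) := by
  rw [exceedances, Finset.sum_filter]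
  rfl

lemma numExceedances_eq_sum (x : ℕ → ℝ) (n : ℕ) (t : ℝ) :
    (numExceedances x n t : ℝ) = ∑ j ∈ Finset.range n, excessPow t 0 (x j) := by
  rw [← sum_exceedances_pow]
  simp [numExceedances]

lemma meanExcess_eq_sum (x : ℕ → ℝ) (n : ℕ) (t : ℝ) :
    meanExcess x n t = (∑ j ∈ Finset.range n, excessPow t 1 (x j)) /
      ∑ j ∈ Finset.range n, excessPow t 0 (x j) := by
  rw [meanExcess, numExceedances_eq_sum, ← sum_exceedances_pow x n t 1]
  simp only [pow_one]

/-! ### Algebra and deterministic asymptotics of the coefficient of variation -/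

/-- The coefficient of variation as a function of the power sums `s₀, s₁, s₂` of the excesses. -/
noncomputable def cvOfSums (d s₀ s₁ s₂ : ℝ) : ℝ :=
  √((s₂ - s₁ ^ 2 / s₀) / (s₀ - d)) / (s₁ / s₀)

lemma residualCV_eq_cvOfSums (d : ℕ) (x : ℕ → ℝ) (n : ℕ) (t : ℝ) :
    residualCV d x n t = cvOfSums d (∑ j ∈ Finset.range n, excessPow t 0 (x j))
      (∑ j ∈ Finset.range n, excessPow t 1 (x j)) (∑ j ∈ Finset.range n, excessPow t 2 (x j)) := by
  have h : ∑ j ∈ exceedances x n t, ((x j - t) - meanExcess x n t) ^ 2 =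
      (∑ j ∈ Finset.range n, excessPow t 2 (x j)) -
        (∑ j ∈ Finset.range n, excessPow t 1 (x j)) ^ 2 /
          ∑ j ∈ Finset.range n, excessPow t 0 (x j) := by
    have hexp : ∑ j ∈ exceedances x n t, ((x j - t) - meanExcess x n t) ^ 2 =
        (∑ j ∈ exceedances x n t, (x j - t) ^ 2) -
          2 * meanExcess x n t * (∑ j ∈ exceedances x n t, (x j - t) ^ 1) +
          meanExcess x n t ^ 2 * ∑ j ∈ exceedances x n t, (x j - t) ^ 0 := by
      rw [Finset.mul_sum, Finset.mul_sum, ← Finset.sum_sub_distrib, ← Finset.sum_add_distrib]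
      exact Finset.sum_congr rfl fun j _ => by ring
    rw [hexp, sum_exceedances_pow, sum_exceedances_pow, sum_exceedances_pow, meanExcess_eq_sum]
    by_cases h0 : ∑ j ∈ Finset.range n, excessPow t 0 (x j) = 0
    · simp [h0]
    · field_simp
      ring
  rw [residualCV, sdExcess, h, numExceedances_eq_sum, meanExcess_eq_sum, cvOfSums]

/-- Homogeneity allows sums to be replaced by averages, at the price of turning the divisor
correction `d` into `d / n`. -/
lemma cvOfSums_mul (d s₀ s₁ s₂ : ℝ) {r : ℝ} (hr : r ≠ 0) :
    cvOfSums d (r * s₀) (r * s₁) (r * s₂) = cvOfSums (d / r) s₀ s₁ s₂ := by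
  have h1 : r * s₂ - (r * s₁) ^ 2 / (r * s₀) = r * (s₂ - s₁ ^ 2 / s₀) := by
    by_cases h : s₀ = 0
    · simp [h]
    · field_simp
  have h2 : r * s₀ - d = r * (s₀ - d / r) := by field_simp
  rw [cvOfSums, cvOfSums, h1, h2, mul_div_mul_left _ _ hr, mul_div_mul_left _ _ hr]

/-- Squaring removes the root, and 1/(a - δ) = (1/a)(1 + δ/(a - δ)) isolates the effect of the
divisor. -/
lemma cvOfSums_sq_sub {δ a b e q c : ℝ} (ha : 0 < a) (hδ : 0 < a - δ) (hb : 0 < b)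
    (he : 0 ≤ e - b ^ 2 / a) (hq : q = 1 + c ^ 2) :
    cvOfSums δ a b e ^ 2 - c ^ 2 =
      (a * e - q * b ^ 2) / b ^ 2 + (a * e - b ^ 2) / b ^ 2 * (δ / (a - δ)) := by
  rw [cvOfSums, div_pow, Real.sq_sqrt (div_nonneg he hδ.le), hq]
  field_simp
  ring

lemma inv_sqrt_eq_sqrt_div (x : ℝ) : (√x)⁻¹ = √x / x := by
  rw [Real.sqrt_div_self', one_div]

/-- The deterministic expansion behind the asymptotic normality of the coefficient of variation:
if the averaged power sums `a n, b n, e n` of the excesses converge, then `√(n a) (cv - c)` is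
asymptotically a multiple of `√n (a e - (1 + c²) b²)`. -/
lemma tendsto_cvOfSums_expansion {a b e : ℕ → ℝ} {p m₁ m₂ c : ℝ} (d : ℝ) (hp : 0 < p)
    (hm : 0 < m₁) (hc : 0 < c) (hm₂ : m₂ = (1 + c ^ 2) * m₁ ^ 2)
    (ha : Tendsto a atTop (𝓝 p)) (hb : Tendsto b atTop (𝓝 (p * m₁)))
    (he : Tendsto e atTop (𝓝 (p * m₂))) :
    Tendsto (fun n : ℕ => √(a n) / (b n ^ 2 * (cvOfSums (d / n) (a n) (b n) (e n) + c))) atTop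
        (𝓝 (√p / ((p * m₁) ^ 2 * (2 * c)))) ∧
      Tendsto (fun n : ℕ => √(n * a n) * (cvOfSums (d / n) (a n) (b n) (e n) - c) -
        √(a n) / (b n ^ 2 * (cvOfSums (d / n) (a n) (b n) (e n) + c)) *
          (√n * (a n * e n - (1 + c ^ 2) * b n ^ 2))) atTop (𝓝 0) := by
  have hδ : Tendsto (fun n : ℕ => d / (n : ℝ)) atTop (𝓝 0) := tendsto_const_div_atTop_nhds_zero_nat d
  have hden : Tendsto (fun n : ℕ => a n - d / n) atTop (𝓝 p) := by
    simpa using ha.sub hδ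
  have hnum : Tendsto (fun n => e n - b n ^ 2 / a n) atTop (𝓝 (p * (c * m₁) ^ 2)) := by
    have h : p * m₂ - (p * m₁) ^ 2 / p = p * (c * m₁) ^ 2 := by
      rw [hm₂]
      field_simp
      ring
    exact h ▸ he.sub ((hb.pow 2).div ha hp.ne')
  have hcv : Tendsto (fun n : ℕ => cvOfSums (d / n) (a n) (b n) (e n)) atTop (𝓝 c) := by
    have h := ((hnum.div hden hp.ne').sqrt).div (hb.div ha hp.ne') (by positivity)
    rw [mul_div_cancel_left₀ _ hp.ne', mul_div_cancel_left₀ _ hp.ne', Real.sqrt_sq (by positivity),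
      mul_div_cancel_right₀ _ hm.ne'] at h
    exact h
  have hK : Tendsto (fun n : ℕ => √(a n) / (b n ^ 2 * (cvOfSums (d / n) (a n) (b n) (e n) + c)))
      atTop (𝓝 (√p / ((p * m₁) ^ 2 * (2 * c)))) := by
    rw [two_mul]
    exact ha.sqrt.div ((hb.pow 2).mul (hcv.add_const c)) (by positivity)
  refine ⟨hK, ?_⟩
  have hsq : Tendsto (fun n : ℕ => d * (√(n : ℝ))⁻¹) atTop (𝓝 0) := by
    simpa using (tendsto_inv_atTop_zero.comp
      (Real.tendsto_sqrt_atTop.comp tendsto_natCast_atTop_atTop)).const_mul d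
  -- This product is exactly the remainder: the divisor changes the result only by a term of order
  -- d/√n.
  have hR := (hsq.mul hK).mul (((ha.mul he).sub (hb.pow 2)).div hden hp.ne')
  rw [zero_mul, zero_mul] at hR
  refine hR.congr' ?_
  filter_upwards [ha.eventually_const_lt hp, hb.eventually_const_lt (mul_pos hp hm),
    hden.eventually_const_lt hp, hnum.eventually_const_lt (by positivity : 0 < p * (c * m₁) ^ 2),
    eventually_gt_atTop 0] with n h1 h2 h3 h4 h5
  have h5' : (0 : ℝ) < n := by exact_mod_cast h5
  have key := cvOfSums_sq_sub h1 h3 h2 h4.le (rfl : 1 + c ^ 2 = _)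
  have hcv0 : 0 ≤ cvOfSums (d / n) (a n) (b n) (e n) := by
    unfold cvOfSums; positivity
  generalize cvOfSums (d / n) (a n) (b n) (e n) = v at key hcv0 ⊢
  have hv : v - c = ((a n * e n - (1 + c ^ 2) * b n ^ 2) / b n ^ 2 +
      (a n * e n - b n ^ 2) / b n ^ 2 * (d / n / (a n - d / n))) / (v + c) := by
    rw [← key, eq_div_iff (by positivity)]
    ring
  rw [hv, Real.sqrt_mul h5'.le, inv_sqrt_eq_sqrt_div, Pi.div_apply]
  have hvc : v + c ≠ 0 := by positivity
  generalize a n - d / n = D at *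
  field_simp
  ring

/-! ### Central limit theorem and Slutsky's theorem -/

section
variable {Ω : Type*} [MeasurableSpace Ω] {P : Measure Ω} [IsProbabilityMeasure P]

/-- The squared average of centered i.i.d. square integrable variables is `o(1 / √n)` in
probability. -/
lemma tendstoInMeasure_sqrt_mul_average_sq {V : ℕ → Ω → ℝ} (hV : MemLp (V 0) 2 P)
    (hzero : P[V 0] = 0) (hindep : iIndepFun V P)
    (hident : ∀ i, IdentDistrib (V i) (V 0) P P) :
    TendstoInMeasure P (fun (n : ℕ) ω => √n * ((∑ j ∈ Finset.range n, V j ω) / n) ^ 2) atTop 0 := by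
  have hL (i : ℕ) : MemLp (V i) 2 P := (hident i).memLp_iff.2 hV
  have hsum (n : ℕ) : MemLp (fun ω => ∑ j ∈ Finset.range n, V j ω) 2 P :=
    memLp_finsetSum _ fun i _ => hL i
  have hint (n : ℕ) : ∫ ω, (∑ j ∈ Finset.range n, V j ω) ^ 2 ∂P = n * Var[V 0; P] := by
    have hmean : ∫ ω, (∑ j ∈ Finset.range n, V j ω) ∂P = 0 := by
      rw [integral_finsetSum _ fun i _ => (hL i).integrable one_le_two]
      exact Finset.sum_eq_zero fun i _ => by rw [(hident i).integral_eq, hzero]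
    rw [← variance_of_integral_eq_zero (hsum n).aemeasurable hmean]
    have h := IndepFun.variance_sum (s := Finset.range n) (fun i _ => hL i)
      (fun i _ j _ hij => hindep.indepFun hij)
    have hfun : (fun ω => ∑ j ∈ Finset.range n, V j ω) = ∑ j ∈ Finset.range n, V j := by
      ext; simp
    rw [hfun, h, Finset.sum_congr rfl fun i _ => (hident i).variance_eq]
    simp
  -- Markov's inequality: the expectation is √n · Var/n = Var/√n.
  rw [tendstoInMeasure_iff_measureReal_norm]
  intro ε hε
  have hbound (n : ℕ) : P.real {ω | ε ≤ ‖√n * ((∑ j ∈ Finset.range n, V j ω) / n) ^ 2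
      - (0 : Ω → ℝ) ω‖} ≤ Var[V 0; P] * (√(n : ℝ))⁻¹ / ε := by
    have hnn (ω : Ω) : 0 ≤ √n * ((∑ j ∈ Finset.range n, V j ω) / n) ^ 2 := by positivity
    have hI : Integrable (fun ω => √n * ((∑ j ∈ Finset.range n, V j ω) / n) ^ 2) P := by
      simp_rw [div_pow]
      exact ((hsum n).integrable_sq.div_const _).const_mul _
    have hval : ∫ ω, √n * ((∑ j ∈ Finset.range n, V j ω) / n) ^ 2 ∂P =
        Var[V 0; P] * (√(n : ℝ))⁻¹ := by
      simp_rw [div_pow]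
      rw [integral_const_mul, integral_div, hint, inv_sqrt_eq_sqrt_div]
      rcases eq_or_ne (n : ℝ) 0 with h | h
      · simp [h]
      · field_simp
    have hM := mul_meas_ge_le_integral_of_nonneg (ae_of_all P hnn) hI ε
    rw [hval] at hM
    rw [le_div_iff₀ hε, mul_comm]
    simpa only [Pi.zero_apply, sub_zero, Real.norm_of_nonneg (hnn _)] using hM
  refine squeeze_zero (fun _ => measureReal_nonneg) hbound ?_
  simpa using ((tendsto_inv_atTop_zero.comp
      (Real.tendsto_sqrt_atTop.comp tendsto_natCast_atTop_atTop)).const_mul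
        (Var[V 0; P])).div_const ε

/-- Asymptotic normality of the empirical coefficient of variation of the excesses over `t`, for an
i.i.d. sample whose excesses have conditional moments `m k` and exceedance probability `p`. -/
theorem tendstoInDistribution_residualCV {X : ℕ → Ω → ℝ} {t p c : ℝ} {m : ℕ → ℝ} (d : ℕ)
    (hindep : iIndepFun X P) (hident : ∀ i, IdentDistrib (X i) (X 0) P P)
    (hint : ∀ k ≤ 4, Integrable (fun ω => excessPow t k (X 0 ω)) P)
    (hmom : ∀ k ≤ 4, ∫ ω, excessPow t k (X 0 ω) ∂P = p * m k)
    (hp : 0 < p) (hm0 : m 0 = 1) (hm1 : 0 < m 1) (hc : 0 < c)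
    (hm2 : m 2 = (1 + c ^ 2) * m 1 ^ 2) :
    TendstoInDistribution
      (fun (n : ℕ) (ω : Ω) =>
        √(numExceedances (fun j => X j ω) n t : ℝ) * (residualCV d (fun j => X j ω) n t - c))
      atTop (id : ℝ → ℝ) (fun _ => P)
      (gaussianReal 0 ((m 4 - 4 * m 2 * m 3 / m 1 + 4 * m 2 ^ 3 / m 1 ^ 2 - m 2 ^ 2) /
        (4 * c ^ 2 * m 1 ^ 4)).toNNReal) := by
  have hX (i : ℕ) : AEMeasurable (X i) P := (hident i).aemeasurable_fst
  have hfm (k i : ℕ) : AEMeasurable (fun ω => excessPow t k (X i ω)) P :=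
    (measurable_excessPow t k).comp_aemeasurable (hX i)
  -- power sums
  let S (k n : ℕ) (ω : Ω) : ℝ := ∑ j ∈ Finset.range n, excessPow t k (X j ω)
  have hSm (k n : ℕ) : AEMeasurable (S k n) P :=
    Finset.aemeasurable_fun_sum _ fun i _ => hfm k i
  have hlln (k : ℕ) (hk : k ≤ 4) : ∀ᵐ ω ∂P, Tendsto (fun n : ℕ => S k n ω / n) atTop
      (𝓝 (p * m k)) := by
    rw [← hmom k hk]
    exact strong_law_ae_real (fun i ω => excessPow t k (X i ω)) (hint k hk)
      (fun i j hij => (hindep.indepFun hij).comp (measurable_excessPow t k)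
        (measurable_excessPow t k))
      (fun i => (hident i).comp (measurable_excessPow t k))
  -- the linear part and the part of the mean
  let w (x : ℝ) : ℝ :=
    excessPow t 2 x - 2 * (m 2 / m 1) * excessPow t 1 x + m 2 * excessPow t 0 x
  let v (x : ℝ) : ℝ := excessPow t 1 x - m 1 * excessPow t 0 x
  have hw : Measurable w := (((measurable_excessPow t 2).sub
    ((measurable_excessPow t 1).const_mul _)).add ((measurable_excessPow t 0).const_mul _))
  have hv : Measurable v := (measurable_excessPow t 1).sub ((measurable_excessPow t 0).const_mul _)
  have hI0 := hint 0 (by norm_num)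
  have hI1 := hint 1 (by norm_num)
  have hI2 := hint 2 (by norm_num)
  have hI3 := hint 3 (by norm_num)
  have hI4 := hint 4 (by norm_num)
  have hwsq (x : ℝ) : w x ^ 2 = excessPow t 4 x - 4 * (m 2 / m 1) * excessPow t 3 x +
      (4 * (m 2 / m 1) ^ 2 + 2 * m 2) * excessPow t 2 x - 4 * (m 2 ^ 2 / m 1) * excessPow t 1 x +
      m 2 ^ 2 * excessPow t 0 x := by
    have h00 := excessPow_mul t 0 0 x
    have h01 := excessPow_mul t 0 1 x
    have h02 := excessPow_mul t 0 2 x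
    have h11 := excessPow_mul t 1 1 x
    have h12 := excessPow_mul t 1 2 x
    have h22 := excessPow_mul t 2 2 x
    simp only [zero_add, Nat.reduceAdd] at h00 h01 h02 h11 h12 h22
    simp only [w]
    linear_combination h22 - 4 * (m 2 / m 1) * h12 + (4 * (m 2 / m 1) ^ 2) * h11 +
      2 * m 2 * h02 - 4 * (m 2 ^ 2 / m 1) * h01 + m 2 ^ 2 * h00
  have hvsq (x : ℝ) : v x ^ 2 = excessPow t 2 x - 2 * m 1 * excessPow t 1 x +
      m 1 ^ 2 * excessPow t 0 x := by
    have h00 := excessPow_mul t 0 0 x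
    have h01 := excessPow_mul t 0 1 x
    have h11 := excessPow_mul t 1 1 x
    simp only [zero_add, Nat.reduceAdd] at h00 h01 h11
    simp only [v]
    linear_combination h11 - 2 * m 1 * h01 + m 1 ^ 2 * h00
  have hwL : MemLp (fun ω => w (X 0 ω)) 2 P := by
    refine (memLp_two_iff_integrable_sq
      (hw.comp_aemeasurable (hX 0)).aestronglyMeasurable).2 ?_
    simp only [Function.comp_apply, hwsq]
    exact ((((hI4.sub (hI3.const_mul _)).add (hI2.const_mul _)).sub (hI1.const_mul _)).add
      (hI0.const_mul _))
  have hvL : MemLp (fun ω => v (X 0 ω)) 2 P := by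
    refine (memLp_two_iff_integrable_sq
      (hv.comp_aemeasurable (hX 0)).aestronglyMeasurable).2 ?_
    simp only [Function.comp_apply, hvsq]
    exact (hI2.sub (hI1.const_mul _)).add (hI0.const_mul _)
  have hw0 : ∫ ω, w (X 0 ω) ∂P = 0 := by
    simp only [w]
    rw [integral_add, integral_sub, integral_const_mul, integral_const_mul,
      hmom 0 (by norm_num), hmom 1 (by norm_num), hmom 2 (by norm_num), hm0]
    · field_simp
      ring
    all_goals fun_prop
  have hv0 : ∫ ω, v (X 0 ω) ∂P = 0 := by
    simp only [v]
    rw [integral_sub hI1 (hI0.const_mul _), integral_const_mul,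
      hmom 0 (by norm_num), hmom 1 (by norm_num), hm0]
    ring
  have hwvar : Var[fun ω => w (X 0 ω); P] =
      p * (m 4 - 4 * m 2 * m 3 / m 1 + 4 * m 2 ^ 3 / m 1 ^ 2 - m 2 ^ 2) := by
    rw [variance_of_integral_eq_zero hwL.aemeasurable hw0]
    simp_rw [hwsq]
    rw [integral_add, integral_sub, integral_add, integral_sub, integral_const_mul,
      integral_const_mul, integral_const_mul, integral_const_mul, hmom 0 (by norm_num),
      hmom 1 (by norm_num), hmom 2 (by norm_num), hmom 3 (by norm_num), hmom 4 (by norm_num), hm0]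
    · field_simp
      ring
    all_goals fun_prop
  -- central limit theorem for the linear part
  set τ := m 4 - 4 * m 2 * m 3 / m 1 + 4 * m 2 ^ 3 / m 1 ^ 2 - m 2 ^ 2 with hτ
  set K := √p / ((p * m 1) ^ 2 * (2 * c)) with hK
  have hKpos : 0 < K := by positivity
  -- The limit is realized on the line with its final law, so the limit of the linear part must be
  -- x/(K p): the factors p and K supplied later by Slutsky's theorem restore x.
  have hlaw : HasLaw (fun x : ℝ => (K * p)⁻¹ * x)
      (gaussianReal 0 Var[fun ω => w (X 0 ω); P].toNNReal)
      (gaussianReal 0 (τ / (4 * c ^ 2 * m 1 ^ 4)).toNNReal) := by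
    refine ⟨by fun_prop, ?_⟩
    rw [gaussianReal_map_const_mul, mul_zero, hwvar]
    congr 1
    have h1 : NNReal.mk (((K * p)⁻¹) ^ 2) (sq_nonneg _) = (((K * p)⁻¹) ^ 2).toNNReal :=
      (Real.toNNReal_of_nonneg (sq_nonneg _)).symm
    rw [h1, ← Real.toNNReal_mul (sq_nonneg _)]
    congr 1
    rw [hK]
    have hsp : √p ^ 2 = p := Real.sq_sqrt hp.le
    field_simp
    rw [hsp]
    ring
  have hCLT := tendstoInDistribution_inv_sqrt_mul_sum_sub (X := fun i ω => w (X i ω)) hlaw hwL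
    (hindep.comp (fun _ => w) fun _ => hw) (fun i => (hident i).comp hw)
  simp only [hw0, mul_zero, sub_zero] at hCLT
  -- Slutsky: first the bilinear form, then the coefficient of variation itself
  have hA : TendstoInMeasure P (fun (n : ℕ) ω => S 0 n ω / n) atTop (fun _ => p) := by
    refine tendstoInMeasure_of_tendsto_ae (fun n => ((hSm 0 n).div_const _).aestronglyMeasurable) ?_
    simpa [hm0] using hlln 0 (by norm_num)
  have hlin := hCLT.continuous_comp_prodMk_of_tendstoInMeasure_const
    (g := fun y : ℝ × ℝ => y.1 * y.2) (by fun_prop) hA (fun n => (hSm 0 n).div_const _)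
  have hrem : TendstoInMeasure P (fun (n : ℕ) ω => -(1 + c ^ 2) * (√n *
      ((∑ j ∈ Finset.range n, v (X j ω)) / n) ^ 2)) atTop (fun _ => 0) := by
    have h := tendstoInMeasure_sqrt_mul_average_sq hvL hv0
      (hindep.comp (fun _ => v) fun _ => hv) (fun i => (hident i).comp hv)
    rw [tendstoInMeasure_iff_norm] at h ⊢
    intro ε hε
    have hq : 0 < 1 + c ^ 2 := by positivity
    convert h (ε / (1 + c ^ 2)) (by positivity) using 5 with n ω
    simp only [Pi.zero_apply, sub_zero, norm_mul, norm_neg, Real.norm_of_nonneg hq.le]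
    rw [div_le_iff₀ hq, mul_comm]
    rfl
  have hvm (n : ℕ) : AEMeasurable (fun ω => ∑ j ∈ Finset.range n, v (X j ω)) P :=
    Finset.aemeasurable_fun_sum _ fun i _ => hv.comp_aemeasurable (hX i)
  have hQ := hlin.add_of_tendstoInMeasure_const hrem
    (fun n => (((hvm n).div_const _).pow_const 2).const_mul _ |>.const_mul _)
  set Q : ℕ → Ω → ℝ := fun n ω =>
    √n * (S 0 n ω / n * (S 2 n ω / n) - (1 + c ^ 2) * (S 1 n ω / n) ^ 2) with hQdef
  -- The identity a e - (1 + c²) b² = a W - (1 + c²) V² is exact, by `hm2`.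
  have hQ' : TendstoInDistribution Q atTop (fun x : ℝ => (K * p)⁻¹ * x * p + 0) (fun _ => P)
      (gaussianReal 0 (τ / (4 * c ^ 2 * m 1 ^ 4)).toNNReal) := by
    convert hQ using 1
    ext n ω
    simp only [Pi.add_apply, hQdef]
    have e1 : ∑ j ∈ Finset.range n, w (X j ω) =
        S 2 n ω - 2 * (m 2 / m 1) * S 1 n ω + m 2 * S 0 n ω := by
      simp only [w, S, Finset.sum_add_distrib, Finset.sum_sub_distrib, Finset.mul_sum]
    have e2 : ∑ j ∈ Finset.range n, v (X j ω) = S 1 n ω - m 1 * S 0 n ω := by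
      simp only [v, S, Finset.sum_sub_distrib, Finset.mul_sum]
    rw [e1, e2, hm2, inv_sqrt_eq_sqrt_div]
    rcases eq_or_ne (n : ℝ) 0 with h | h
    · simp [h]
    · field_simp
      ring
  let cv (n : ℕ) (ω : Ω) : ℝ := cvOfSums ((d : ℝ) / n) (S 0 n ω / n) (S 1 n ω / n) (S 2 n ω / n)
  have hcvm (n : ℕ) : AEMeasurable (cv n) P := by
    have h0 := hSm 0 n
    have h1 := hSm 1 n
    have h2 := hSm 2 n
    simp only [cv, cvOfSums]
    fun_prop
  let k (n : ℕ) (ω : Ω) : ℝ := √(S 0 n ω / n) / ((S 1 n ω / n) ^ 2 * (cv n ω + c))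
  have hkm (n : ℕ) : AEMeasurable (k n) P := by
    have h0 := hSm 0 n
    have h1 := hSm 1 n
    have h2 := hcvm n
    simp only [k]
    fun_prop
  let T (n : ℕ) (ω : Ω) : ℝ := √(n * (S 0 n ω / n)) * (cv n ω - c)
  have hTm (n : ℕ) : AEMeasurable (T n) P := by
    have h0 := hSm 0 n
    have h2 := hcvm n
    simp only [T]
    fun_prop
  have hQm := hQ'.forall_aemeasurable
  have hrm (n : ℕ) : AEMeasurable (fun ω => (k n ω, T n ω - k n ω * Q n ω)) P :=
    (hkm n).prodMk ((hTm n).sub ((hkm n).mul (hQm n)))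
  -- The strong law lets the deterministic expansion be applied path by path.
  have hpair : TendstoInMeasure P (fun (n : ℕ) ω => (k n ω, T n ω - k n ω * Q n ω)) atTop
      (fun _ => (K, (0 : ℝ))) := by
    refine tendstoInMeasure_of_tendsto_ae (fun n => (hrm n).aestronglyMeasurable) ?_
    filter_upwards [hlln 0 (by norm_num), hlln 1 (by norm_num), hlln 2 (by norm_num)] with ω
      h0 h1 h2
    rw [hm0, mul_one] at h0
    have h := tendsto_cvOfSums_expansion (d : ℝ) hp hm1 hc hm2 h0 h1 h2
    exact h.1.prodMk_nhds h.2
  have hfin := hQ'.continuous_comp_prodMk_of_tendstoInMeasure_const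
    (g := fun y : ℝ × (ℝ × ℝ) => y.2.1 * y.1 + y.2.2) (by fun_prop) hpair hrm
  refine hfin.congr (fun n => ae_of_all P fun ω => ?_) (ae_of_all _ fun x => ?_)
  · simp only [T, cv]
    rw [numExceedances_eq_sum, residualCV_eq_cvOfSums]
    rcases eq_or_ne (n : ℝ) 0 with h | h
    · have hn : n = 0 := by exact_mod_cast h
      subst hn
      simp
    · have e := cvOfSums_mul (d : ℝ) (S 0 n ω / n) (S 1 n ω / n) (S 2 n ω / n) h
      rw [← e, mul_div_cancel₀ _ h, mul_div_cancel₀ _ h, mul_div_cancel₀ _ h]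
      ring
  · simp only [id]
    field_simp
    ring
end

/-! ### The generalized Pareto law as an image of the exponential law -/

/-- The increasing function that transports the standard exponential law to `GPD(ξ, ψ)`. -/
noncomputable def gpdOfExp (ξ ψ u : ℝ) : ℝ :=
  if ξ = 0 then ψ * u else ψ * (Real.exp (ξ * u) - 1) / ξ

lemma gpdOfExp_zero (ξ ψ : ℝ) : gpdOfExp ξ ψ 0 = 0 := by simp [gpdOfExp]

lemma add_mul_gpdOfExp (ξ ψ u : ℝ) : ψ + ξ * gpdOfExp ξ ψ u = ψ * Real.exp (ξ * u) := by
  unfold gpdOfExp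
  split_ifs with h
  · simp [h]
  · field_simp
    ring

/-- Flow property of q' = ψ + ξ q: restarted at level q(u), the increment solves the same equation
with scale ψ + ξ q(u). This is the threshold stability of the GPD. -/
lemma gpdOfExp_add (ξ ψ u v : ℝ) :
    gpdOfExp ξ ψ (u + v) = gpdOfExp ξ ψ u + gpdOfExp ξ (ψ + ξ * gpdOfExp ξ ψ u) v := by
  rw [add_mul_gpdOfExp]
  unfold gpdOfExp
  split_ifs with h
  · simp [h, mul_add]
  · rw [mul_add, Real.exp_add]
    ring

lemma hasDerivAt_gpdOfExp (ξ ψ u : ℝ) :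
    HasDerivAt (gpdOfExp ξ ψ) (ψ + ξ * gpdOfExp ξ ψ u) u := by
  rw [add_mul_gpdOfExp]
  by_cases h : ξ = 0
  · have hf : gpdOfExp ξ ψ = fun u => ψ * u := by ext; simp [gpdOfExp, h]
    rw [hf, h]
    simpa using (hasDerivAt_id u).const_mul ψ
  · have hf : gpdOfExp ξ ψ = fun u => ψ * (Real.exp (ξ * u) - 1) / ξ := by ext; simp [gpdOfExp, h]
    rw [hf]
    convert! (((((hasDerivAt_id u).const_mul ξ).exp).sub_const 1).const_mul ψ).div_const ξ using 1
    simp only [id]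
    field_simp

lemma continuous_gpdOfExp (ξ ψ : ℝ) : Continuous (gpdOfExp ξ ψ) :=
  continuous_iff_continuousAt.2 fun u => (hasDerivAt_gpdOfExp ξ ψ u).continuousAt

lemma strictMono_gpdOfExp (ξ : ℝ) {ψ : ℝ} (hψ : 0 < ψ) : StrictMono (gpdOfExp ξ ψ) := by
  refine strictMono_of_deriv_pos fun u => ?_
  rw [(hasDerivAt_gpdOfExp ξ ψ u).deriv, add_mul_gpdOfExp]
  positivity

lemma gpdOfExp_nonneg (ξ : ℝ) {ψ u : ℝ} (hψ : 0 < ψ) (hu : 0 ≤ u) : 0 ≤ gpdOfExp ξ ψ u := by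
  rw [← gpdOfExp_zero ξ ψ]
  exact (strictMono_gpdOfExp ξ hψ).monotone hu

lemma gpdOfExp_le (ξ : ℝ) {ψ : ℝ} (hψ : 0 < ψ) (u : ℝ) :
    gpdOfExp ξ ψ u ≤ ψ * (u * Real.exp (max ξ 0 * u)) := by
  unfold gpdOfExp
  split_ifs with h
  · simp [h]
  · rw [mul_div_assoc]
    refine mul_le_mul_of_nonneg_left ?_ hψ.le
    rcases lt_or_gt_of_ne h with h | h
    · rw [max_eq_right h.le, zero_mul, Real.exp_zero, mul_one, div_le_iff_of_neg h]
      linarith [Real.add_one_le_exp (ξ * u)]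
    · rw [max_eq_left h.le, div_le_iff₀ h]
      have h1 := Real.add_one_le_exp (-(ξ * u))
      have h2 : Real.exp (-(ξ * u)) * Real.exp (ξ * u) = 1 := by rw [← Real.exp_add]; simp
      nlinarith [Real.exp_pos (ξ * u), mul_le_mul_of_nonneg_right h1 (Real.exp_pos (ξ * u)).le]

/-- The inverse of `gpdOfExp`, on the range `0 < ψ + ξ x`. -/
noncomputable def expOfGPD (ξ ψ x : ℝ) : ℝ :=
  if ξ = 0 then x / ψ else Real.log (1 + ξ * x / ψ) / ξ

lemma gpdOfExp_expOfGPD {ξ ψ x : ℝ} (hψ : 0 < ψ) (hx : 0 < 1 + ξ * x / ψ) :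
    gpdOfExp ξ ψ (expOfGPD ξ ψ x) = x := by
  unfold gpdOfExp expOfGPD
  split_ifs with h
  · field_simp
  · rw [mul_div_cancel₀ _ h, Real.exp_log hx]
    field_simp
    ring

lemma exp_neg_expOfGPD {ξ ψ x : ℝ} (hx : 0 < 1 + ξ * x / ψ) :
    Real.exp (-expOfGPD ξ ψ x) =
      if ξ = 0 then Real.exp (-x / ψ) else (1 + ξ * x / ψ) ^ (-1 / ξ) := by
  unfold expOfGPD
  split_ifs with h
  · rw [neg_div]
  · rw [Real.rpow_def_of_pos hx]
    congr 1
    ring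

/-- `GPD(ξ, ψ)` is the image of the standard exponential law. -/
lemma IsGPD.eq_map_expMeasure {ξ ψ : ℝ} {ν : Measure ℝ} (hψ : 0 < ψ) (hν : IsGPD ξ ψ ν) :
    ν = (expMeasure 1).map (gpdOfExp ξ ψ) := by
  have := hν.1
  have hE : IsProbabilityMeasure (expMeasure 1) := isProbabilityMeasure_expMeasure one_pos
  have hmeas : Measurable (gpdOfExp ξ ψ) := (continuous_gpdOfExp ξ ψ).measurable
  have : IsProbabilityMeasure ((expMeasure 1).map (gpdOfExp ξ ψ)) :=
    Measure.isProbabilityMeasure_map hmeas.aemeasurable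
  have hmono := strictMono_gpdOfExp ξ hψ
  refine Measure.eq_of_cdf _ _ ?_
  ext x
  rw [hν.2 x, cdf_eq_real, map_measureReal_apply hmeas measurableSet_Iic]
  rcases lt_or_ge 0 (1 + ξ * x / ψ) with hx | hx
  · have hq := gpdOfExp_expOfGPD hψ hx
    have hset : gpdOfExp ξ ψ ⁻¹' Set.Iic x = Set.Iic (expOfGPD ξ ψ x) := by
      ext u
      rw [Set.mem_preimage, Set.mem_Iic, Set.mem_Iic, ← hmono.le_iff_le (b := expOfGPD ξ ψ x), hq]
    rw [hset, ← cdf_eq_real, cdf_expMeasure_eq one_pos, one_mul, exp_neg_expOfGPD hx, gpdCDF]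
    have hsign : 0 ≤ expOfGPD ξ ψ x ↔ 0 ≤ x := by
      rw [← hmono.le_iff_le, hq, gpdOfExp_zero]
    rcases lt_trichotomy x 0 with h | h | h
    · rw [if_pos h.le, if_neg (by rw [hsign]; exact h.not_ge)]
    · simp [h]
    · rw [if_neg h.not_ge, if_pos (hsign.2 h.le), if_neg hx.not_ge]
      split_ifs <;> rfl
  -- Here `x` is outside the range of q: above it if ξ < 0, below it if ξ > 0.
  · have hξ : ξ ≠ 0 := by
      rintro rfl
      norm_num at hx
    have hbound (u : ℝ) : ξ * x < ξ * gpdOfExp ξ ψ u := by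
      have h1 := add_mul_gpdOfExp ξ ψ u
      have h2 : 0 < ψ * Real.exp (ξ * u) := by positivity
      have h3 : ψ + ξ * x ≤ 0 := by
        have := mul_nonpos_of_nonneg_of_nonpos hψ.le hx
        field_simp at this
        linarith
      linarith
    rw [gpdCDF]
    rcases lt_or_gt_of_ne hξ with h | h
    · have hset : gpdOfExp ξ ψ ⁻¹' Set.Iic x = Set.univ := by
        ext u
        simpa using ((mul_lt_mul_left_of_neg h).1 (hbound u)).le
      have hx0 : 0 < x := by
        have := (mul_lt_mul_left_of_neg h).1 (hbound 0)
        rwa [gpdOfExp_zero] at this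
      rw [hset, if_neg hx0.not_ge, if_neg hξ, if_pos hx]
      simp
    · have hset : gpdOfExp ξ ψ ⁻¹' Set.Iic x = ∅ := by
        ext u
        simpa using (mul_lt_mul_iff_right₀ h).1 (hbound u)
      have hx0 : x < 0 := by
        have := (mul_lt_mul_iff_right₀ h).1 (hbound 0)
        rwa [gpdOfExp_zero] at this
      rw [hset, if_pos hx0.le]
      simp

/-! ### Moments of the excesses -/

lemma exists_isBigO_gpdOfExp_pow_mul_exp_neg {ξ ψ : ℝ} {k : ℕ} (hψ : 0 < ψ) (hk : k * ξ < 1) :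
    ∃ b > 0, (fun u => gpdOfExp ξ ψ u ^ k * Real.exp (-u)) =O[atTop] fun u => Real.exp (-b * u) := by
  set β : ℝ := 1 - k * max ξ 0 with hβdef
  have hβ : 0 < β := by
    rcases max_cases ξ 0 with h | h <;> rw [hβdef, h.1] <;> linarith
  -- Half of the decay rate β is spent on absorbing the factor u^k.
  refine ⟨β / 2, by positivity, ?_⟩
  have h1 : (fun u => gpdOfExp ξ ψ u ^ k * Real.exp (-u)) =O[atTop]
      fun u => u ^ k * Real.exp (-β * u) := by
    refine Asymptotics.IsBigO.of_bound (ψ ^ k) ?_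
    filter_upwards [eventually_ge_atTop 0] with u hu
    have hq := gpdOfExp_nonneg ξ hψ hu
    rw [Real.norm_of_nonneg (by positivity), Real.norm_of_nonneg (by positivity)]
    calc gpdOfExp ξ ψ u ^ k * Real.exp (-u)
        ≤ (ψ * (u * Real.exp (max ξ 0 * u))) ^ k * Real.exp (-u) := by
          gcongr
          exact gpdOfExp_le ξ hψ u
      _ = ψ ^ k * (u ^ k * Real.exp (-β * u)) := by
          rw [mul_pow, mul_pow, ← Real.exp_nat_mul, mul_assoc, mul_assoc, ← Real.exp_add]
          congr 4
          rw [hβdef]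
          ring
  refine h1.trans ?_
  have h2 := (isLittleO_pow_exp_pos_mul_atTop k (half_pos hβ)).isBigO.mul
    (Asymptotics.isBigO_refl (fun u => Real.exp (-β * u)) atTop)
  refine h2.congr_right fun u => ?_
  rw [← Real.exp_add]
  congr 1
  ring

lemma integrableOn_gpdOfExp_pow_mul_exp_neg {ξ ψ : ℝ} {k : ℕ} (hψ : 0 < ψ) (hk : k * ξ < 1) :
    IntegrableOn (fun u => gpdOfExp ξ ψ u ^ k * Real.exp (-u)) (Set.Ioi 0) := by
  obtain ⟨b, hb, h⟩ := exists_isBigO_gpdOfExp_pow_mul_exp_neg hψ hk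
  have := continuous_gpdOfExp ξ ψ
  exact integrable_of_isBigO_exp_neg hb (by fun_prop) h

lemma tendsto_gpdOfExp_pow_mul_exp_neg {ξ ψ : ℝ} {k : ℕ} (hψ : 0 < ψ) (hk : k * ξ < 1) :
    Tendsto (fun u => gpdOfExp ξ ψ u ^ k * Real.exp (-u)) atTop (𝓝 0) := by
  obtain ⟨b, hb, h⟩ := exists_isBigO_gpdOfExp_pow_mul_exp_neg hψ hk
  refine h.trans_tendsto (Real.tendsto_exp_atBot.comp ?_)
  exact tendsto_id.const_mul_atTop_of_neg (neg_lt_zero.2 hb)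

/-- The `k`-th moment of `GPD(ξ, ψ)`, for `k ξ < 1`. -/
noncomputable def gpdMoment (ξ ψ : ℝ) (k : ℕ) : ℝ :=
  ∏ i ∈ Finset.range k, ((i + 1) * ψ / (1 - (i + 1) * ξ))

/-- Integrating the derivative of q^(k+1) e^(-u), whose boundary values vanish, gives (k+1) ψ M_k =
(1 - (k+1) ξ) M_(k+1). -/
lemma integral_gpdOfExp_pow_mul_exp_neg {ξ ψ : ℝ} {k : ℕ} (hψ : 0 < ψ) (hk : k * ξ < 1) :
    ∫ u in Set.Ioi 0, gpdOfExp ξ ψ u ^ k * Real.exp (-u) = gpdMoment ξ ψ k := by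
  induction k with
  | zero => simpa [gpdMoment] using integral_exp_Iic_zero
  | succ k ih =>
    have hk' : k * ξ < 1 := by
      rcases le_or_gt ξ 0 with h | h
      · nlinarith [(Nat.cast_nonneg k : (0 : ℝ) ≤ k)]
      · push_cast at hk
        linarith
    have hi := integrableOn_gpdOfExp_pow_mul_exp_neg hψ hk
    have hi' := integrableOn_gpdOfExp_pow_mul_exp_neg hψ hk'
    have hderiv (u : ℝ) : HasDerivAt (fun u => gpdOfExp ξ ψ u ^ (k + 1) * Real.exp (-u))
        ((k + 1) * ψ * (gpdOfExp ξ ψ u ^ k * Real.exp (-u)) -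
          (1 - (k + 1) * ξ) * (gpdOfExp ξ ψ u ^ (k + 1) * Real.exp (-u))) u := by
      convert! ((hasDerivAt_gpdOfExp ξ ψ u).pow (k + 1)).mul (hasDerivAt_neg u).exp using 1
      simp only [Pi.pow_apply, Nat.add_sub_cancel, Nat.cast_add, Nat.cast_one]
      ring
    have hint := integral_Ioi_of_hasDerivAt_of_tendsto' (a := 0) (fun u _ => hderiv u)
      ((hi'.const_mul _).sub (hi.const_mul _)) (tendsto_gpdOfExp_pow_mul_exp_neg hψ hk)
    rw [integral_sub (hi'.const_mul _) (hi.const_mul _), integral_const_mul, integral_const_mul,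
      ih hk', gpdOfExp_zero] at hint
    push_cast at hk
    have hne : 1 - (k + 1) * ξ ≠ 0 := by linarith
    rw [gpdMoment, Finset.prod_range_succ, ← gpdMoment]
    simp at hint
    field_simp
    linarith

lemma excessPow_gpdOfExp {ξ ψ t : ℝ} (hψ : 0 < ψ) (ht : 0 < 1 + ξ * t / ψ) (k : ℕ) (u : ℝ) :
    excessPow t k (gpdOfExp ξ ψ u) =
      (Set.Ioi 0).indicator (fun v => gpdOfExp ξ (ψ + ξ * t) v ^ k) (u - expOfGPD ξ ψ t) := by
  have hq := gpdOfExp_expOfGPD hψ ht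
  have hadd := gpdOfExp_add ξ ψ (expOfGPD ξ ψ t) (u - expOfGPD ξ ψ t)
  rw [hq, add_sub_cancel] at hadd
  have hiff : t < gpdOfExp ξ ψ u ↔ u - expOfGPD ξ ψ t ∈ Set.Ioi 0 := by
    rw [Set.mem_Ioi, sub_pos, ← (strictMono_gpdOfExp ξ hψ).lt_iff_lt (b := u), hq]
  rw [excessPow, Set.indicator_apply]
  simp only [hiff]
  rw [hadd, add_sub_cancel_left]

/-- The excesses of `GPD(ξ, ψ)` over `t` have the moments of `GPD(ξ, ψ + ξ t)`. -/
lemma IsGPD.integral_excessPow {ξ ψ t : ℝ} {ν : Measure ℝ} {k : ℕ} (hν : IsGPD ξ ψ ν)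
    (hψ : 0 < ψ) (ht : 0 ≤ t) (htop : 0 < ψ + ξ * t) (hk : k * ξ < 1) :
    Integrable (excessPow t k) ν ∧
      ∫ x, excessPow t k x ∂ν = Real.exp (-expOfGPD ξ ψ t) * gpdMoment ξ (ψ + ξ * t) k := by
  have htop' : 0 < 1 + ξ * t / ψ := by
    have : 1 + ξ * t / ψ = (ψ + ξ * t) / ψ := by field_simp
    rw [this]
    positivity
  set e := expOfGPD ξ ψ t with he
  -- With t ≥ 0, the region u > e lies inside the support of the exponential density.
  have he0 : 0 ≤ e := by
    rw [← (strictMono_gpdOfExp ξ hψ).le_iff_le, he, gpdOfExp_expOfGPD hψ htop', gpdOfExp_zero]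
    exact ht
  have hmeas : Measurable (gpdOfExp ξ ψ) := (continuous_gpdOfExp ξ ψ).measurable
  let H : ℝ → ℝ :=
    (Set.Ioi 0).indicator fun v => gpdOfExp ξ (ψ + ξ * t) v ^ k * Real.exp (-v)
  have hH : Integrable H := (integrable_indicator_iff measurableSet_Ioi).2
    (integrableOn_gpdOfExp_pow_mul_exp_neg htop hk)
  have hHint : ∫ v, H v = gpdMoment ξ (ψ + ξ * t) k := by
    rw [integral_indicator measurableSet_Ioi, integral_gpdOfExp_pow_mul_exp_neg htop hk]
  -- Lack of memory: e^(-u) = e^(-e) e^(-(u - e)), the first factor being the exceedance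
  -- probability.
  have hdens (u : ℝ) : (gammaPDF 1 1 u).toReal • excessPow t k (gpdOfExp ξ ψ u) =
      Real.exp (-e) * H (u - e) := by
    change (exponentialPDF 1 u).toReal • _ = _
    rw [exponentialPDF_eq, excessPow_gpdOfExp hψ htop', ← he]
    simp only [H, Set.indicator_apply, Set.mem_Ioi]
    split_ifs with h1 h2 h2
    · have : Real.exp (-u) = Real.exp (-e) * Real.exp (-(u - e)) := by
        rw [← Real.exp_add]
        congr 1
        ring
      rw [one_mul, one_mul, ENNReal.toReal_ofReal (Real.exp_pos _).le, smul_eq_mul, this]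
      ring
    · simp
    · linarith
    · simp
  have hpdf : Measurable (gammaPDF 1 1) := (measurable_gammaPDFReal 1 1).ennreal_ofReal
  have hlt : ∀ᵐ u : ℝ, gammaPDF 1 1 u < ⊤ := ae_of_all _ fun u => ENNReal.ofReal_lt_top
  rw [hν.eq_map_expMeasure hψ, expMeasure, gammaMeasure]
  constructor
  · rw [integrable_map_measure (measurable_excessPow t k).aestronglyMeasurable hmeas.aemeasurable,
      integrable_withDensity_iff_integrable_smul' hpdf hlt]
    simp only [Function.comp_apply, hdens]
    exact (hH.comp_sub_right e).const_mul _
  · rw [integral_map hmeas.aemeasurable (measurable_excessPow t k).aestronglyMeasurable,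
      integral_withDensity_eq_integral_toReal_smul hpdf hlt]
    simp only [hdens]
    rw [integral_const_mul, integral_sub_right_eq_self, hHint]

/-! ### The theorem -/

theorem corollary4 {Ω : Type*} [MeasurableSpace Ω] (P : Measure Ω) [IsProbabilityMeasure P]
    (ξ ψ t : ℝ) (hξ : ξ < 1 / 4) (hψ : 0 < ψ) (ht : 0 ≤ t)
    (htop : 0 < ψ + ξ * t)
    (X : ℕ → Ω → ℝ) (hmeas : ∀ j, AEMeasurable (X j) P) (hindep : iIndepFun X P)
    (hlaw : ∀ j, IsGPD ξ ψ (P.map (X j)))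
    (d : ℕ) (hd : d = 0 ∨ d = 1) :
    TendstoInDistribution
      (fun (n : ℕ) (ω : Ω) =>
        √(numExceedances (fun j => X j ω) n t : ℝ) *
          (residualCV d (fun j => X j ω) n t - gpdCV ξ))
      atTop (id : ℝ → ℝ) (fun _ => P) (gaussianReal 0 (gpdAsympVar ξ).toNNReal) ∧
    gpdAsympVar 0 = 1 ∧ gpdAsympVar (-1) = 8 / 45 := by
  refine ⟨?_, by norm_num [gpdAsympVar], by norm_num [gpdAsympVar]⟩
  have hident (i : ℕ) : IdentDistrib (X i) (X 0) P P :=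
    ⟨hmeas i, hmeas 0, by rw [(hlaw i).eq_map_expMeasure hψ, (hlaw 0).eq_map_expMeasure hψ]⟩
  have hkξ (k : ℕ) (hk : k ≤ 4) : k * ξ < 1 := by
    have hk0 : (0 : ℝ) ≤ k := Nat.cast_nonneg k
    have hk4 : (k : ℝ) ≤ 4 := by exact_mod_cast hk
    rcases le_or_gt ξ 0 with h | h <;> nlinarith
  have hexc (k : ℕ) (hk : k ≤ 4) := (hlaw 0).integral_excessPow hψ ht htop (hkξ k hk)
  have h1 : 0 < 1 - ξ := by linarith
  have h2 : 0 < 1 - 2 * ξ := by linarith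
  have h3 : 0 < 1 - 3 * ξ := by linarith
  have h4 : 0 < 1 - 4 * ξ := by linarith
  have hcsq : gpdCV ξ ^ 2 = 1 / (1 - 2 * ξ) := Real.sq_sqrt (by positivity)
  have hc : 0 < gpdCV ξ := Real.sqrt_pos.2 (by positivity)
  have hm1 : gpdMoment ξ (ψ + ξ * t) 1 = (ψ + ξ * t) / (1 - ξ) := by
    norm_num [gpdMoment]
  have hm2 : gpdMoment ξ (ψ + ξ * t) 2 = 2 * (ψ + ξ * t) ^ 2 / ((1 - ξ) * (1 - 2 * ξ)) := by
    norm_num [gpdMoment, Finset.prod_range_succ]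
    field_simp
  have hm3 : gpdMoment ξ (ψ + ξ * t) 3 =
      6 * (ψ + ξ * t) ^ 3 / ((1 - ξ) * (1 - 2 * ξ) * (1 - 3 * ξ)) := by
    norm_num [gpdMoment, Finset.prod_range_succ]
    field_simp
    norm_num
  have hm4 : gpdMoment ξ (ψ + ξ * t) 4 =
      24 * (ψ + ξ * t) ^ 4 / ((1 - ξ) * (1 - 2 * ξ) * (1 - 3 * ξ) * (1 - 4 * ξ)) := by
    norm_num [gpdMoment, Finset.prod_range_succ]
    field_simp
    norm_num
  have key := tendstoInDistribution_residualCV (m := gpdMoment ξ (ψ + ξ * t)) d hindep hident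
    (fun k hk => (integrable_map_measure (measurable_excessPow t k).aestronglyMeasurable
      (hmeas 0)).1 (hexc k hk).1)
    (fun k hk => by
      rw [← (hexc k hk).2,
        integral_map (hmeas 0) (measurable_excessPow t k).aestronglyMeasurable])
    (Real.exp_pos _) (by simp [gpdMoment]) (by rw [hm1]; positivity) hc
    (by
      rw [hcsq, hm1, hm2]
      field_simp
      ring)
  -- Numerator and denominator are both homogeneous of degree 4 in the scale ψ + ξ t, which
  -- therefore cancels.
  have hvar : (gpdMoment ξ (ψ + ξ * t) 4 -
      4 * gpdMoment ξ (ψ + ξ * t) 2 * gpdMoment ξ (ψ + ξ * t) 3 / gpdMoment ξ (ψ + ξ * t) 1 +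
      4 * gpdMoment ξ (ψ + ξ * t) 2 ^ 3 / gpdMoment ξ (ψ + ξ * t) 1 ^ 2 -
      gpdMoment ξ (ψ + ξ * t) 2 ^ 2) / (4 * gpdCV ξ ^ 2 * gpdMoment ξ (ψ + ξ * t) 1 ^ 4) =
      gpdAsympVar ξ := by
    rw [hcsq, hm1, hm2, hm3, hm4, gpdAsympVar]
    generalize ψ + ξ * t = s at htop
    have h2' : 1 - ξ * 2 ≠ 0 := by rw [mul_comm]; exact h2.ne'
    have h3' : 1 - ξ * 3 ≠ 0 := by rw [mul_comm]; exact h3.ne'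
    have h4' : 1 - ξ * 4 ≠ 0 := by rw [mul_comm]; exact h4.ne'
    field_simp
    ring
  rwa [hvar] at key
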